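/- Let $d\ge 1$, $p>1$, $s\in(0,1)$ and $\alpha_1,\alpha_2\in\mathbb R$, put $\alpha=\alpha_1+\alpha_2$, and assume $\alpha_1p,\ \alpha_2p\in(-d,sp)$, $0\le\alpha p<sp$ and $sp-\alpha p<d$. For a measurable function $u:\mathbb R^d\to\mathbb R$ let $$[u]_{W^{s,p,\alpha}}=\Big(\int_{\mathbb R^d}\int_{\mathbb R^d}\frac{|u(x)-u(y)|^p}{|x-y|^{d+sp}}\,|x|^{\alpha_1p}|y|^{\alpha_2p}\,dx\,dy\Big)^{1/p}\in[0,\infty],$$ let $W^{s,p,\alpha}(\mathbb R^d)$ be the closure of $C^1_c(\mathbb R^d)$ in $L^p(\mathbb R^d)$ with respect to the norm $\big(\|u\|_{L^p}^p+[u]_{W^{s,p,\alpha}}^p\big)^{1/p}$, and for $q>p$ let $\mathcal D^{p,q}_{s,\alpha}=(W^{s,p,\alpha}(\mathbb R^d)\cap L^q(\mathbb R^d))\setminus\{0\}$. Then there is a constant $\mathcal C_\alpha>0$ depending only on $d,p,s,\alpha_1,\alpha_2$, which is a constant for the weighted fractional Sobolev inequality $$\|u\|_{L^{p^*_{s,\alpha}}(\mathbb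 R^d)}\le\mathcal C_\alpha^{1/p}\,[u]_{W^{s,p,\alpha}}\quad\text{for all }u\in W^{s,p,\alpha}(\mathbb R^d),\qquad p^*_{s,\alpha}=\frac{dp}{d-sp+\alpha p},$$ such that the following holds. For every $q$ with $p<q<\frac{p(d-s+\alpha)}{d-sp+\alpha p}$, with $$r=p\,\frac{q-1}{p-1},\qquad a=\frac{d(q-p)}{(q-1)\big(dp-(d-sp+\alpha p)q\big)},$$ one has $dp-(d-sp+\alpha p)q>0$, and for all $u\in\mathcal D^{p,q}_{s,\alpha}$ $$\|u\|_{L^r(\mathbb R^d)}\le\mathcal C_\alpha^{a/p}\,[u]_{W^{s,p,\alpha}}^{a}\,\|u\|_{L^q(\mathbb R^d)}^{1-a}.$$ -/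

import Mathlib

open MeasureTheory Filter Topology
open scoped ENNReal

noncomputable section

/-- The weighted Gagliardo seminorm
`[u] = (∫∫ |u x - u y|^p / |x - y|^(d + s p) * |x|^(α₁ p) * |y|^(α₂ p) dx dy)^(1/p)`, with values
in `[0, ∞]`. The integrand is nonnegative; its values on the null sets `x = y`, `x = 0`, `y = 0`
are irrelevant. -/
def weightedGagliardo (d : ℕ) (s p α₁ α₂ : ℝ) (u : EuclideanSpace ℝ (Fin d) → ℝ) : ℝ≥0∞ :=
  (∫⁻ y : EuclideanSpace ℝ (Fin d), ∫⁻ x : EuclideanSpace ℝ (Fin d),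
    ENNReal.ofReal (|u x - u y| ^ p / ‖x - y‖ ^ ((d : ℝ) + s * p)
      * ‖x‖ ^ (α₁ * p) * ‖y‖ ^ (α₂ * p))) ^ (1 / p)

/-- The weighted norm `(‖u‖_{L^p}^p + [u]^p)^(1/p)`, with values in `[0, ∞]`. -/
def weightedSobolevNorm (d : ℕ) (s p α₁ α₂ : ℝ) (u : EuclideanSpace ℝ (Fin d) → ℝ) : ℝ≥0∞ :=
  (eLpNorm u (ENNReal.ofReal p) volume ^ p + weightedGagliardo d s p α₁ α₂ u ^ p) ^ (1 / p)

/-- The weighted fractional Sobolev space `W^{s,p,α}(ℝ^d)`, `α = α₁ + α₂`: the functions in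
`L^p` that are limits, in the weighted norm, of compactly supported `C^1` functions. -/
def WeightedSobolev (d : ℕ) (s p α₁ α₂ : ℝ) : Set (EuclideanSpace ℝ (Fin d) → ℝ) :=
  {u | MemLp u (ENNReal.ofReal p) volume ∧
    ∃ φ : ℕ → EuclideanSpace ℝ (Fin d) → ℝ,
      (∀ n, ContDiff ℝ 1 (φ n) ∧ HasCompactSupport (φ n)) ∧
      Tendsto (fun n => weightedSobolevNorm d s p α₁ α₂ (u - φ n)) atTop (𝓝 0)}

/-- The space `(W^{s,p,α}(ℝ^d) ∩ L^q(ℝ^d)) \ {0}`; as usual, `0` is the class of functions that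
vanish almost everywhere. -/
def WeightedD (d : ℕ) (s p q α₁ α₂ : ℝ) : Set (EuclideanSpace ℝ (Fin d) → ℝ) :=
  {u | u ∈ WeightedSobolev d s p α₁ α₂ ∧ MemLp u (ENNReal.ofReal q) volume ∧
    ¬ u =ᵐ[volume] 0}

end

/-! The interpolation inequality is Hölder between `L^P` and `L^q`, `P = p*_{s,α}`, followed by the
weighted Sobolev inequality; all the work is in the latter. Put `b = sp - αp`, so `0 < b < d`. Hardy
(`exists_hardy`): comparing `u x` with its averages over a far annulus bounds `∫ |x|^(-b) |u|^p` by
the energy plus a small multiple of itself, which is absorbed. Sobolev: `exists_pointwise_scale`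
bounds `|u x|^p` at every scale `r` by `r^b (W x + r^(-d) ‖u‖_P^p)`, up to a constant, where `W` is
the energy density plus the Hardy density. The best `r` turns this into `|u|^P ≤ K ‖u‖_P^(P-p) W`.
Integrating, using Hardy and cancelling the finite power of `‖u‖_P` gives the claim; truncation and
Fatou remove the finiteness assumption. -/

/-! ### Averaging estimates for the kernel -/

/-- The integrand of the weighted Gagliardo energy, with exponent `e` on `‖z - x‖` and
weights `‖z‖ ^ a₁ * ‖x‖ ^ a₂`. -/
noncomputable def gagliardoKernel {d : ℕ} (p e a₁ a₂ : ℝ) (u : EuclideanSpace ℝ (Fin d) → ℝ)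
    (z x : EuclideanSpace ℝ (Fin d)) : ℝ≥0∞ :=
  ENNReal.ofReal (|u z - u x| ^ p / ‖z - x‖ ^ e * ‖z‖ ^ a₁ * ‖x‖ ^ a₂)

/-- The weighted Gagliardo energy, that is, the `p`-th power of the seminorm. -/
noncomputable def gagliardoEnergy {d : ℕ} (p e a₁ a₂ : ℝ) (u : EuclideanSpace ℝ (Fin d) → ℝ) : ℝ≥0∞ :=
  ∫⁻ x, ∫⁻ z, gagliardoKernel p e a₁ a₂ u z x

theorem weightedGagliardo_eq (d : ℕ) (s p α₁ α₂ : ℝ) (u : EuclideanSpace ℝ (Fin d) → ℝ) :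
    weightedGagliardo d s p α₁ α₂ u
      = gagliardoEnergy p ((d : ℝ) + s * p) (α₁ * p) (α₂ * p) u ^ (1 / p) := rfl

theorem Real.rpow_le_rpow_abs_mul_rpow {l x z a : ℝ} (hl : 0 < l) (hx : 0 < x) (hz : 0 < z)
    (hxz : x ≤ l * z) (hzx : z ≤ l * x) : x ^ a ≤ l ^ |a| * z ^ a := by
  rcases le_total 0 a with ha | ha
  · rw [abs_of_nonneg ha, ← Real.mul_rpow hl.le hz.le]
    exact Real.rpow_le_rpow hx.le hxz ha
  · have h := Real.rpow_le_rpow_of_nonpos hz hzx ha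
    rw [Real.mul_rpow hl.le hx.le] at h
    rw [abs_of_nonpos ha, Real.rpow_neg hl.le, inv_mul_eq_div, le_div_iff₀ (by positivity),
      mul_comm]
    exact h

/-- When `‖z‖` and `‖x‖` are comparable, the weight at `z` can be moved to `x` at the cost `l ^
|a₁|`, whatever the sign of `a₁`; only `a₁ + a₂` then matters. -/
theorem enorm_sub_rpow_le_gagliardoKernel {d : ℕ} {p e a₁ a₂ l ρ : ℝ}
    {u : EuclideanSpace ℝ (Fin d) → ℝ} {z x : EuclideanSpace ℝ (Fin d)}
    (hp : 0 < p) (he : 0 ≤ e) (hl : 0 < l) (hx : x ≠ 0)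
    (hxz : ‖x‖ ≤ l * ‖z‖) (hzx : ‖z‖ ≤ l * ‖x‖) (hρ : ‖z - x‖ ≤ ρ) :
    ‖u z - u x‖ₑ ^ p
      ≤ ENNReal.ofReal (l ^ |a₁| * ρ ^ e * ‖x‖ ^ (-(a₁ + a₂))) * gagliardoKernel p e a₁ a₂ u z x := by
  have hx0 : 0 < ‖x‖ := norm_pos_iff.2 hx
  have hz0 : 0 < ‖z‖ := by
    by_contra h
    have : ‖z‖ = 0 := le_antisymm (not_lt.1 h) (norm_nonneg _)
    rw [this] at hxz
    linarith
  have hρ0 : 0 ≤ ρ := (norm_nonneg _).trans hρ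
  rw [gagliardoKernel, ← ENNReal.ofReal_mul (by positivity), Real.enorm_eq_ofReal_abs,
    ENNReal.ofReal_rpow_of_nonneg (abs_nonneg _) hp.le]
  refine ENNReal.ofReal_le_ofReal ?_
  rcases eq_or_ne z x with rfl | hne
  · rw [sub_self, abs_zero, Real.zero_rpow hp.ne']
    positivity
  have hd0 : 0 < ‖z - x‖ := norm_pos_iff.2 (sub_ne_zero.2 hne)
  have h1 := Real.rpow_le_rpow_abs_mul_rpow (a := a₁) hl hx0 hz0 hxz hzx
  have h2 : ‖z - x‖ ^ e ≤ ρ ^ e := Real.rpow_le_rpow hd0.le hρ he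
  have h3 : ‖x‖ ^ (-(a₁ + a₂)) * ‖x‖ ^ a₂ * ‖x‖ ^ a₁ = 1 := by
    rw [← Real.rpow_add hx0, ← Real.rpow_add hx0]
    simp
  have ht : 0 ≤ |u z - u x| ^ p := by positivity
  calc |u z - u x| ^ p
      = |u z - u x| ^ p / ‖z - x‖ ^ e * ‖z - x‖ ^ e
          * (‖x‖ ^ (-(a₁ + a₂)) * ‖x‖ ^ a₂ * ‖x‖ ^ a₁) := by
        rw [h3, mul_one, div_mul_cancel₀ _ (by positivity)]
    _ ≤ |u z - u x| ^ p / ‖z - x‖ ^ e * ρ ^ e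
          * (‖x‖ ^ (-(a₁ + a₂)) * ‖x‖ ^ a₂ * (l ^ |a₁| * ‖z‖ ^ a₁)) := by gcongr
    _ = _ := by ring

/-- Split `u x = u z - (u z - u x)` and integrate over `z ∈ S`. Used with an annulus for Hardy and
with a ball for Sobolev. -/
theorem volume_mul_enorm_rpow_le {d : ℕ} {p e a₁ a₂ l ρ : ℝ}
    {u : EuclideanSpace ℝ (Fin d) → ℝ} {x : EuclideanSpace ℝ (Fin d)}
    (hp : 1 ≤ p) (he : 0 ≤ e) (hl : 0 < l) (hx : x ≠ 0) (hu : Measurable u)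
    {S : Set (EuclideanSpace ℝ (Fin d))} (hS : MeasurableSet S)
    (hxz : ∀ z ∈ S, ‖x‖ ≤ l * ‖z‖) (hzx : ∀ z ∈ S, ‖z‖ ≤ l * ‖x‖) (hρ : ∀ z ∈ S, ‖z - x‖ ≤ ρ) :
    volume S * ‖u x‖ₑ ^ p
      ≤ 2 ^ (p - 1) * (ENNReal.ofReal (l ^ |a₁| * ρ ^ e * ‖x‖ ^ (-(a₁ + a₂)))
          * (∫⁻ z, gagliardoKernel p e a₁ a₂ u z x) + ∫⁻ z in S, ‖u z‖ₑ ^ p) := by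
  have h2 : (2 : ℝ≥0∞) ^ (p - 1) ≠ ∞ := by
    exact ENNReal.rpow_ne_top_of_nonneg (by linarith) (by simp)
  calc volume S * ‖u x‖ₑ ^ p = ∫⁻ z in S, ‖u x‖ₑ ^ p := by rw [setLIntegral_const, mul_comm]
    _ ≤ ∫⁻ z in S, 2 ^ (p - 1) * (ENNReal.ofReal (l ^ |a₁| * ρ ^ e * ‖x‖ ^ (-(a₁ + a₂)))
          * gagliardoKernel p e a₁ a₂ u z x + ‖u z‖ₑ ^ p) := by
        refine setLIntegral_mono' hS fun z hz => ?_
        calc ‖u x‖ₑ ^ p ≤ (‖u z - u x‖ₑ + ‖u z‖ₑ) ^ p := by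
              gcongr
              calc ‖u x‖ₑ = ‖u z - (u z - u x)‖ₑ := by congr 1; ring
                _ ≤ ‖u z‖ₑ + ‖u z - u x‖ₑ := enorm_sub_le
                _ = _ := add_comm _ _
          _ ≤ 2 ^ (p - 1) * (‖u z - u x‖ₑ ^ p + ‖u z‖ₑ ^ p) :=
              ENNReal.rpow_add_le_mul_rpow_add_rpow _ _ hp
          _ ≤ _ := by
              gcongr
              exact enorm_sub_rpow_le_gagliardoKernel (by linarith) he hl hx (hxz z hz) (hzx z hz)
                (hρ z hz)
    _ = 2 ^ (p - 1) * (ENNReal.ofReal (l ^ |a₁| * ρ ^ e * ‖x‖ ^ (-(a₁ + a₂)))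
          * (∫⁻ z in S, gagliardoKernel p e a₁ a₂ u z x) + ∫⁻ z in S, ‖u z‖ₑ ^ p) := by
        rw [lintegral_const_mul' _ _ h2, lintegral_add_right _ (by fun_prop),
          lintegral_const_mul' _ _ ENNReal.ofReal_ne_top]
    _ ≤ _ := by
        gcongr
        exact Measure.restrict_le_self

/-! ### The fractional Hardy inequality -/

theorem measurableSet_annulus {d : ℕ} (r R : ℝ) :
    MeasurableSet {z : EuclideanSpace ℝ (Fin d) | r ≤ ‖z‖ ∧ ‖z‖ ≤ R} := by
  change MeasurableSet ({z : EuclideanSpace ℝ (Fin d) | r ≤ ‖z‖} ∩ {z | ‖z‖ ≤ R})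
  exact (measurableSet_le (by fun_prop) (by fun_prop)).inter
    (measurableSet_le (by fun_prop) (by fun_prop))

/-- The annulus contains the ball of radius `2r` minus that of radius `r`, and `2 ^ d - 1 ≥ 1` for
`d ≠ 0`. -/
theorem ofReal_pow_mul_volume_le_volume_annulus {d : ℕ} (hd : d ≠ 0) {r : ℝ} (hr : 0 < r) :
    ENNReal.ofReal (r ^ d) * volume (Metric.ball (0 : EuclideanSpace ℝ (Fin d)) 1)
      ≤ volume {z : EuclideanSpace ℝ (Fin d) | r ≤ ‖z‖ ∧ ‖z‖ ≤ 2 * r} := by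
  have hb := Measure.addHaar_ball_of_pos volume (0 : EuclideanSpace ℝ (Fin d)) hr
  have hc := Measure.addHaar_closedBall volume (0 : EuclideanSpace ℝ (Fin d))
    (by positivity : 0 ≤ 2 * r)
  rw [finrank_euclideanSpace_fin] at hb hc
  have hsub : Metric.closedBall (0 : EuclideanSpace ℝ (Fin d)) (2 * r)
      ⊆ {z | r ≤ ‖z‖ ∧ ‖z‖ ≤ 2 * r} ∪ Metric.ball 0 r := by
    intro z hz
    rw [mem_closedBall_zero_iff] at hz
    rcases lt_or_ge ‖z‖ r with h | h
    · exact Or.inr (mem_ball_zero_iff.2 h)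
    · exact Or.inl ⟨h, hz⟩
  have h1 := (measure_mono hsub).trans (measure_union_le (μ := volume) _ _)
  rw [← hb]
  refine ENNReal.le_of_add_le_add_right (measure_ball_lt_top (μ := volume)).ne (le_trans ?_ h1)
  rw [hb, hc, ← two_mul, ← mul_assoc]
  gcongr
  rw [← ENNReal.ofReal_ofNat 2, ← ENNReal.ofReal_mul (by norm_num)]
  refine ENNReal.ofReal_le_ofReal ?_
  rw [mul_pow]
  gcongr
  exact le_self_pow₀ (by norm_num) hd

theorem exists_one_le_mul_rpow_le {b : ℝ} {d : ℕ} (hbd : b < d) (K : ℝ) :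
    ∃ l : ℝ, 1 ≤ l ∧ K * l ^ b ≤ l ^ d := by
  have h := tendsto_rpow_atTop (sub_pos.2 hbd)
  obtain ⟨l, h1, h2⟩ := ((h.eventually_ge_atTop K).and (eventually_ge_atTop 1)).exists
  have hl : 0 < l := by linarith
  refine ⟨l, h2, ?_⟩
  rw [Real.rpow_sub hl, Real.rpow_natCast, le_div_iff₀ (by positivity)] at h1
  exact h1

/-- The pointwise estimate behind the Hardy inequality: average over the annulus
`l * ‖x‖ ≤ ‖z‖ ≤ 2 * l * ‖x‖`. -/
theorem hardy_pointwise {d : ℕ} (hd : d ≠ 0) {p e a₁ a₂ b l : ℝ} (hp : 1 ≤ p) (he : 0 ≤ e)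
    (hb : b = e - d - (a₁ + a₂)) (hl : 1 ≤ l) {u : EuclideanSpace ℝ (Fin d) → ℝ}
    (hu : Measurable u) {x : EuclideanSpace ℝ (Fin d)} (hx : x ≠ 0) :
    ENNReal.ofReal (l ^ d) * volume (Metric.ball (0 : EuclideanSpace ℝ (Fin d)) 1)
        * (ENNReal.ofReal (‖x‖ ^ (-b)) * ‖u x‖ₑ ^ p)
      ≤ 2 ^ (p - 1) * (ENNReal.ofReal ((2 * l) ^ |a₁| * (3 * l) ^ e)
          * (∫⁻ z, gagliardoKernel p e a₁ a₂ u z x)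
          + ENNReal.ofReal (‖x‖ ^ (-(b + d))) *
            ∫⁻ z in {z | l * ‖x‖ ≤ ‖z‖ ∧ ‖z‖ ≤ 2 * (l * ‖x‖)}, ‖u z‖ₑ ^ p) := by
  have hx0 : 0 < ‖x‖ := norm_pos_iff.2 hx
  have hlx : ‖x‖ ≤ l * ‖x‖ := le_mul_of_one_le_left hx0.le hl
  -- On the annulus `‖z - x‖ ≤ 2l‖x‖ + ‖x‖ ≤ 3l‖x‖`, as `l ≥ 1`.
  have h1 := volume_mul_enorm_rpow_le (a₁ := a₁) (a₂ := a₂) (l := 2 * l) (ρ := 3 * l * ‖x‖)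
    hp he (by linarith) hx hu (measurableSet_annulus (l * ‖x‖) (2 * (l * ‖x‖)))
    (fun z hz => by
      have := hz.1
      nlinarith [norm_nonneg z])
    (fun z hz => by
      have := hz.2
      linarith)
    (fun z hz => by
      have := hz.2
      have := norm_sub_le z x
      linarith)
  have h2 := ofReal_pow_mul_volume_le_volume_annulus hd (r := l * ‖x‖) (by positivity)
  -- The factor `‖x‖ ^ (-(b + d))` cancels every power of `‖x‖` in front of the energy; this is what
  -- fixes `b`.
  have h3 := mul_le_mul_right (a := ENNReal.ofReal (‖x‖ ^ (-(b + d)))) ((mul_le_mul_left h2 (‖u x‖ₑ ^ p)).trans h1)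
  have e1 : ‖x‖ ^ (-(b + d)) * (l * ‖x‖) ^ d = l ^ d * ‖x‖ ^ (-b) := by
    rw [mul_pow, ← Real.rpow_natCast ‖x‖ d, mul_left_comm, ← Real.rpow_add hx0]
    congr 2
    ring
  have e2 : ‖x‖ ^ (-(b + d)) * ((2 * l) ^ |a₁| * (3 * l * ‖x‖) ^ e * ‖x‖ ^ (-(a₁ + a₂)))
      = (2 * l) ^ |a₁| * (3 * l) ^ e := by
    rw [Real.mul_rpow (by positivity) hx0.le]
    have : ‖x‖ ^ (-(b + d)) * ‖x‖ ^ e * ‖x‖ ^ (-(a₁ + a₂)) = 1 := by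
      rw [← Real.rpow_add hx0, ← Real.rpow_add hx0, hb]
      ring_nf
      simp
    linear_combination (2 * l) ^ |a₁| * (3 * l) ^ e * this
  have e1' := congrArg ENNReal.ofReal e1
  have e2' := congrArg ENNReal.ofReal e2
  rw [ENNReal.ofReal_mul (by positivity), ENNReal.ofReal_mul (by positivity)] at e1'
  rw [ENNReal.ofReal_mul (by positivity)] at e2'
  rw [← e2']
  calc _ = (ENNReal.ofReal (l ^ d) * ENNReal.ofReal (‖x‖ ^ (-b)))
          * (volume (Metric.ball (0 : EuclideanSpace ℝ (Fin d)) 1) * ‖u x‖ₑ ^ p) := by ring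
    _ = _ := by rw [← e1']; ring
    _ ≤ _ := h3
    _ = _ := by ring

/-- Tonelli: for fixed `z`, the admissible `x` satisfy `‖z‖ / (2l) ≤ ‖x‖ ≤ ‖z‖ / l`. Since `l ≥ 1`,
they force `‖z‖ ≥ ε`, so the same truncated integral returns on the right. The factor `l ^ b` is to
be compared with the volume factor `l ^ d` of the annulus. -/
theorem lintegral_annuli_le {d : ℕ} {p b l ε : ℝ} (hl : 1 ≤ l) (hε : 0 < ε) (hb : 0 < b)
    {u : EuclideanSpace ℝ (Fin d) → ℝ} (hu : Measurable u) :
    ∫⁻ x in {x : EuclideanSpace ℝ (Fin d) | ε ≤ ‖x‖}, ENNReal.ofReal (‖x‖ ^ (-(b + d))) *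
        ∫⁻ z in {z : EuclideanSpace ℝ (Fin d) | l * ‖x‖ ≤ ‖z‖ ∧ ‖z‖ ≤ 2 * (l * ‖x‖)}, ‖u z‖ₑ ^ p
      ≤ ENNReal.ofReal (2 ^ (b + d) * l ^ b)
        * volume (Metric.ball (0 : EuclideanSpace ℝ (Fin d)) 1)
        * ∫⁻ z in {z : EuclideanSpace ℝ (Fin d) | ε ≤ ‖z‖}, ENNReal.ofReal (‖z‖ ^ (-b)) * ‖u z‖ₑ ^ p := by
  have hB : MeasurableSet {x : EuclideanSpace ℝ (Fin d) | ε ≤ ‖x‖} :=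
    measurableSet_le (by fun_prop) (by fun_prop)
  set T : Set (EuclideanSpace ℝ (Fin d) × EuclideanSpace ℝ (Fin d)) :=
    {q | ε ≤ ‖q.1‖ ∧ l * ‖q.1‖ ≤ ‖q.2‖ ∧ ‖q.2‖ ≤ 2 * (l * ‖q.1‖)} with hTdef
  have hT : MeasurableSet T := by
    change MeasurableSet ({q : EuclideanSpace ℝ (Fin d) × EuclideanSpace ℝ (Fin d) | ε ≤ ‖q.1‖}
      ∩ ({q | l * ‖q.1‖ ≤ ‖q.2‖} ∩ {q | ‖q.2‖ ≤ 2 * (l * ‖q.1‖)}))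
    exact (measurableSet_le (by fun_prop) (by fun_prop)).inter
      ((measurableSet_le (by fun_prop) (by fun_prop)).inter
      (measurableSet_le (by fun_prop) (by fun_prop)))
  set G : EuclideanSpace ℝ (Fin d) × EuclideanSpace ℝ (Fin d) → ℝ≥0∞ :=
    T.indicator fun q => ENNReal.ofReal (‖q.1‖ ^ (-(b + d))) * ‖u q.2‖ₑ ^ p with hGdef
  have hG : Measurable G := Measurable.indicator (by fun_prop) hT
  have hleft : ∫⁻ x in {x : EuclideanSpace ℝ (Fin d) | ε ≤ ‖x‖}, ENNReal.ofReal (‖x‖ ^ (-(b + d))) *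
        ∫⁻ z in {z : EuclideanSpace ℝ (Fin d) | l * ‖x‖ ≤ ‖z‖ ∧ ‖z‖ ≤ 2 * (l * ‖x‖)}, ‖u z‖ₑ ^ p
      = ∫⁻ x, ∫⁻ z, G (x, z) := by
    rw [← lintegral_indicator hB]
    refine lintegral_congr fun x => ?_
    by_cases hx : ε ≤ ‖x‖
    · rw [Set.indicator_of_mem (show x ∈ {x | ε ≤ ‖x‖} from hx),
        ← lintegral_const_mul' _ _ ENNReal.ofReal_ne_top, ← lintegral_indicator (measurableSet_annulus _ _)]
      refine lintegral_congr fun z => ?_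
      simp [hGdef, hTdef, Set.indicator, hx]
    · rw [Set.indicator_of_notMem (show x ∉ {x | ε ≤ ‖x‖} from hx)]
      simp [hGdef, hTdef, hx]
  rw [hleft, lintegral_lintegral_swap (f := fun x z => G (x, z)) hG.aemeasurable,
    ← lintegral_indicator hB, ← lintegral_const_mul' _ _ (ENNReal.mul_ne_top ENNReal.ofReal_ne_top
      (measure_ball_lt_top (μ := volume)).ne)]
  refine lintegral_mono fun z => ?_
  by_cases hz : ε ≤ ‖z‖
  · rw [Set.indicator_of_mem (show z ∈ {x | ε ≤ ‖x‖} from hz)]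
    have hz0 : 0 < ‖z‖ := hε.trans_le hz
    have hl0 : 0 < l := by linarith
    calc ∫⁻ x, G (x, z)
        ≤ ∫⁻ x, (Metric.closedBall (0 : EuclideanSpace ℝ (Fin d)) (‖z‖ / l)).indicator
            (fun _ => ENNReal.ofReal ((‖z‖ / (2 * l)) ^ (-(b + d))) * ‖u z‖ₑ ^ p) x := by
          refine lintegral_mono fun x => ?_
          by_cases hxz : (x, z) ∈ T
          · obtain ⟨h1, h2, h3⟩ := hxz
            simp only at h1 h2 h3
            have hx : x ∈ Metric.closedBall (0 : EuclideanSpace ℝ (Fin d)) (‖z‖ / l) := by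
              rw [mem_closedBall_zero_iff, le_div_iff₀ hl0]
              linarith
            rw [Set.indicator_of_mem hx, hGdef, Set.indicator_of_mem (show (x, z) ∈ T from ⟨h1, h2, h3⟩)]
            gcongr ENNReal.ofReal ?_ * _
            refine Real.rpow_le_rpow_of_nonpos (by positivity) ?_
              (by have := Nat.cast_nonneg (α := ℝ) d; linarith)
            rw [div_le_iff₀ (by positivity)]
            linarith
          · rw [hGdef, Set.indicator_of_notMem hxz]
            exact zero_le
      _ = ENNReal.ofReal ((‖z‖ / (2 * l)) ^ (-(b + d))) * ‖u z‖ₑ ^ p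
            * (ENNReal.ofReal ((‖z‖ / l) ^ d)
              * volume (Metric.ball (0 : EuclideanSpace ℝ (Fin d)) 1)) := by
          rw [lintegral_indicator_const Metric.isClosed_closedBall.measurableSet,
            Measure.addHaar_closedBall _ _ (by positivity), finrank_euclideanSpace_fin]
      _ = ENNReal.ofReal ((‖z‖ / (2 * l)) ^ (-(b + d)) * (‖z‖ / l) ^ d)
            * volume (Metric.ball (0 : EuclideanSpace ℝ (Fin d)) 1) * ‖u z‖ₑ ^ p := by
          rw [ENNReal.ofReal_mul (by positivity)]
          ring
      _ = ENNReal.ofReal (2 ^ (b + d) * l ^ b * ‖z‖ ^ (-b))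
            * volume (Metric.ball (0 : EuclideanSpace ℝ (Fin d)) 1) * ‖u z‖ₑ ^ p := by
          congr 3
          rw [Real.rpow_neg (by positivity), Real.rpow_neg hz0.le, ← Real.rpow_natCast,
            Real.div_rpow hz0.le (by positivity), Real.div_rpow hz0.le hl0.le,
            Real.mul_rpow (by norm_num) hl0.le, Real.rpow_add hl0, Real.rpow_add hz0]
          have h1 : 0 < ‖z‖ ^ (d : ℝ) := by positivity
          have h2 : 0 < l ^ (d : ℝ) := by positivity
          have h3 : 0 < ‖z‖ ^ b := by positivity
          field_simp
      _ = _ := by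
          rw [ENNReal.ofReal_mul (by positivity)]
          ring
  · have : ∀ x, G (x, z) = 0 := by
      intro x
      refine Set.indicator_of_notMem ?_ _
      rintro ⟨h1, h2, -⟩
      simp only at h1 h2
      nlinarith [norm_nonneg x]
    simp [this]

theorem ae_ne_zero_euclideanSpace {d : ℕ} (hd : d ≠ 0) :
    ∀ᵐ x : EuclideanSpace ℝ (Fin d), x ≠ 0 := by
  have : Nonempty (Fin d) := ⟨⟨0, Nat.pos_of_ne_zero hd⟩⟩
  exact Measure.ae_ne volume 0

/-- The fractional Hardy inequality. -/
theorem exists_hardy {d : ℕ} (hd : d ≠ 0) {p e a₁ a₂ b : ℝ} (hp : 1 ≤ p)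
    (he : 0 ≤ e) (hb : b = e - d - (a₁ + a₂)) (hb0 : 0 < b) (hbd : b < d) :
    ∃ C : ℝ≥0∞, C ≠ ∞ ∧ ∀ u : EuclideanSpace ℝ (Fin d) → ℝ, Measurable u →
      ∫⁻ x, ‖u x‖ₑ ^ p ≠ ∞ →
      ∫⁻ x, ENNReal.ofReal (‖x‖ ^ (-b)) * ‖u x‖ₑ ^ p ≤ C * gagliardoEnergy p e a₁ a₂ u := by
  -- With this constant the returning term is at most half of the left side; the half is `m`.
  obtain ⟨l, hl, hlb⟩ := exists_one_le_mul_rpow_le hbd (2 * 2 ^ (p - 1) * 2 ^ (b + d))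
  set v := volume (Metric.ball (0 : EuclideanSpace ℝ (Fin d)) 1) with hv
  have hv0 : v ≠ 0 := (Metric.measure_ball_pos volume _ one_pos).ne'
  have hvt : v ≠ ∞ := measure_ball_lt_top.ne
  have h2t : (2 : ℝ≥0∞) ^ (p - 1) ≠ ∞ := ENNReal.rpow_ne_top_of_nonneg (by linarith) (by simp)
  set K := ENNReal.ofReal ((2 * l) ^ |a₁| * (3 * l) ^ e) with hK
  have hl0 : 0 < l := by linarith
  set m := ENNReal.ofReal (l ^ d / 2) * v with hm
  have hm0 : m ≠ 0 := mul_ne_zero (by simp only [ne_eq, ENNReal.ofReal_eq_zero, not_le]; positivity) hv0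
  have hmt : m ≠ ∞ := ENNReal.mul_ne_top ENNReal.ofReal_ne_top hvt
  have hmm : ENNReal.ofReal (l ^ d) * v = m + m := by
    rw [hm, ← add_mul, ← ENNReal.ofReal_add (by positivity) (by positivity), add_halves]
  have hm2 : 2 ^ (p - 1) * (ENNReal.ofReal (2 ^ (b + d) * l ^ b) * v) ≤ m := by
    rw [← mul_assoc, hm]
    gcongr
    rw [← ENNReal.ofReal_ofNat 2, ENNReal.ofReal_rpow_of_pos (by norm_num),
      ← ENNReal.ofReal_mul (by positivity)]
    refine ENNReal.ofReal_le_ofReal ?_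
    linarith
  refine ⟨2 ^ (p - 1) * K / m, ENNReal.div_ne_top (ENNReal.mul_ne_top h2t ENNReal.ofReal_ne_top) hm0,
    fun u hu hup => ?_⟩
  have htrunc : ∀ ε : ℝ, 0 < ε → ∫⁻ x in {x : EuclideanSpace ℝ (Fin d) | ε ≤ ‖x‖},
      ENNReal.ofReal (‖x‖ ^ (-b)) * ‖u x‖ₑ ^ p ≤ 2 ^ (p - 1) * K / m * gagliardoEnergy p e a₁ a₂ u := by
    intro ε hε
    have hB : MeasurableSet {x : EuclideanSpace ℝ (Fin d) | ε ≤ ‖x‖} :=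
      measurableSet_le (by fun_prop) (by fun_prop)
    set N := ∫⁻ x in {x : EuclideanSpace ℝ (Fin d) | ε ≤ ‖x‖},
      ENNReal.ofReal (‖x‖ ^ (-b)) * ‖u x‖ₑ ^ p with hN
    -- Absorption needs a finite `N`; this is why the origin is cut out.
    have hNt : N ≠ ∞ := by
      refine ne_top_of_le_ne_top (ENNReal.mul_ne_top (ENNReal.ofReal_ne_top (r := ε ^ (-b))) hup) ?_
      rw [← lintegral_const_mul' _ _ ENNReal.ofReal_ne_top]
      refine (setLIntegral_mono' hB fun x hx => ?_).trans (setLIntegral_le_lintegral _ _)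
      gcongr ENNReal.ofReal ?_ * _
      exact Real.rpow_le_rpow_of_nonpos hε hx (by linarith)
    have hmain : m * N + m * N ≤ 2 ^ (p - 1) * K * gagliardoEnergy p e a₁ a₂ u + m * N := by
      calc m * N + m * N = ∫⁻ x in {x : EuclideanSpace ℝ (Fin d) | ε ≤ ‖x‖},
            ENNReal.ofReal (l ^ d) * v * (ENNReal.ofReal (‖x‖ ^ (-b)) * ‖u x‖ₑ ^ p) := by
            rw [lintegral_const_mul' _ _ (ENNReal.mul_ne_top ENNReal.ofReal_ne_top hvt), hmm, add_mul]
        _ ≤ ∫⁻ x in {x : EuclideanSpace ℝ (Fin d) | ε ≤ ‖x‖},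
            2 ^ (p - 1) * (K * (∫⁻ z, gagliardoKernel p e a₁ a₂ u z x)
              + ENNReal.ofReal (‖x‖ ^ (-(b + d))) *
            ∫⁻ z in {z | l * ‖x‖ ≤ ‖z‖ ∧ ‖z‖ ≤ 2 * (l * ‖x‖)}, ‖u z‖ₑ ^ p) :=
            setLIntegral_mono' hB fun x hx => hardy_pointwise hd hp he hb hl hu
              (norm_pos_iff.1 (hε.trans_le hx))
        _ = 2 ^ (p - 1) * (K * (∫⁻ x in {x : EuclideanSpace ℝ (Fin d) | ε ≤ ‖x‖},
              ∫⁻ z, gagliardoKernel p e a₁ a₂ u z x)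
              + ∫⁻ x in {x : EuclideanSpace ℝ (Fin d) | ε ≤ ‖x‖}, ENNReal.ofReal (‖x‖ ^ (-(b + d))) *
            ∫⁻ z in {z | l * ‖x‖ ≤ ‖z‖ ∧ ‖z‖ ≤ 2 * (l * ‖x‖)}, ‖u z‖ₑ ^ p) := by
            rw [lintegral_const_mul' _ _ h2t, lintegral_add_left ?_,
              lintegral_const_mul' _ _ ENNReal.ofReal_ne_top]
            refine Measurable.const_mul ?_ _
            refine Measurable.lintegral_prod_right' (f := fun q : EuclideanSpace ℝ (Fin d) ×
              EuclideanSpace ℝ (Fin d) => gagliardoKernel p e a₁ a₂ u q.2 q.1) ?_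
            unfold gagliardoKernel
            fun_prop
        _ ≤ 2 ^ (p - 1) * (K * gagliardoEnergy p e a₁ a₂ u
              + ENNReal.ofReal (2 ^ (b + d) * l ^ b) * v * N) := by
            gcongr
            · exact setLIntegral_le_lintegral _ _
            · exact lintegral_annuli_le hl hε hb0 hu
        _ = 2 ^ (p - 1) * K * gagliardoEnergy p e a₁ a₂ u
              + 2 ^ (p - 1) * (ENNReal.ofReal (2 ^ (b + d) * l ^ b) * v) * N := by ring
        _ ≤ _ := by gcongr
    have hmN := ENNReal.le_of_add_le_add_right (ENNReal.mul_ne_top hmt hNt) hmain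
    rw [ENNReal.div_eq_inv_mul, mul_assoc, ← ENNReal.div_eq_inv_mul,
      ENNReal.le_div_iff_mul_le (Or.inl hm0) (Or.inl hmt), mul_comm]
    exact hmN
  have hU : ∀ᵐ x : EuclideanSpace ℝ (Fin d),
      x ∈ ⋃ n : ℕ, {x : EuclideanSpace ℝ (Fin d) | 1 / ((n : ℝ) + 1) ≤ ‖x‖} := by
    filter_upwards [ae_ne_zero_euclideanSpace hd] with x hx
    obtain ⟨n, hn⟩ := exists_nat_one_div_lt (norm_pos_iff.2 hx)
    exact Set.mem_iUnion.2 ⟨n, hn.le⟩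
  have hU' : (⋃ n : ℕ, {x : EuclideanSpace ℝ (Fin d) | 1 / ((n : ℝ) + 1) ≤ ‖x‖}) =ᵐ[volume]
    Set.univ := eventuallyEq_univ.2 hU
  rw [← setLIntegral_univ, ← Measure.restrict_congr_set hU', setLIntegral_iUnion_of_directed]
  · exact iSup_le fun n => htrunc _ (by positivity)
  · refine Monotone.directed_le fun i j hij x hx => ?_
    have hij' : (i : ℝ) + 1 ≤ j + 1 := by gcongr
    exact (one_div_le_one_div_of_le (by positivity) hij').trans hx

/-! ### Pointwise bounds at a scale and their optimisation -/

/-- The choice `r ^ D = Q / W` makes the two summands equal, whence the factor 2. No such `r` exists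
when `W = 0`, a case left to `hX`. -/
theorem ENNReal.le_of_forall_scale {X W Q c : ℝ≥0∞} {b D : ℝ} (hD : 0 < D) (hbD : b < D)
    (hc : c ≠ 0) (hQ0 : Q ≠ 0) (hQt : Q ≠ ∞) (hX : W = 0 → X = 0)
    (h : ∀ r : ℝ, 0 < r → X ≤ c * ENNReal.ofReal (r ^ b) * (W + ENNReal.ofReal (r ^ (-D)) * Q)) :
    X ≤ 2 * c * (Q ^ (b / D) * W ^ (1 - b / D)) := by
  have hbD' : 0 < 1 - b / D := by
    rw [sub_pos, div_lt_one hD]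
    exact hbD
  rcases eq_or_ne W 0 with hW0 | hW0
  · simp [hX hW0]
  rcases eq_or_ne W ∞ with hWt | hWt
  · have hQb : Q ^ (b / D) ≠ 0 := (ENNReal.rpow_pos (pos_iff_ne_zero.2 hQ0) hQt).ne'
    rw [hWt, ENNReal.top_rpow_of_pos hbD', ENNReal.mul_top hQb, ENNReal.mul_top (by simp [hc])]
    exact le_top
  obtain ⟨w, hw, rfl⟩ : ∃ w : ℝ, 0 < w ∧ ENNReal.ofReal w = W :=
    ⟨W.toReal, ENNReal.toReal_pos hW0 hWt, ENNReal.ofReal_toReal hWt⟩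
  obtain ⟨q, hq, rfl⟩ : ∃ q : ℝ, 0 < q ∧ ENNReal.ofReal q = Q :=
    ⟨Q.toReal, ENNReal.toReal_pos hQ0 hQt, ENNReal.ofReal_toReal hQt⟩
  refine (h ((q / w) ^ (1 / D)) (by positivity)).trans (le_of_eq ?_)
  have e1 : ((q / w) ^ (1 / D)) ^ (-D) * q = w := by
    rw [← Real.rpow_mul (by positivity), mul_neg, one_div_mul_cancel hD.ne', Real.rpow_neg_one]
    field_simp
  have e2 : ((q / w) ^ (1 / D)) ^ b * w = q ^ (b / D) * w ^ (1 - b / D) := by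
    rw [← Real.rpow_mul (by positivity), Real.div_rpow hq.le hw.le, Real.rpow_sub hw,
      Real.rpow_one, one_div_mul_eq_div]
    field_simp
  rw [← ENNReal.ofReal_mul (by positivity), e1, ← two_mul,
    ENNReal.ofReal_rpow_of_pos hq, ENNReal.ofReal_rpow_of_pos hw,
    ← ENNReal.ofReal_mul (by positivity), ← e2, ENNReal.ofReal_mul (by positivity)]
  ring

theorem setLIntegral_enorm_rpow_le {d : ℕ} {p P t : ℝ} (ht0 : 0 ≤ t) (ht1 : t ≤ 1)
    (hP : P * t = p) {u : EuclideanSpace ℝ (Fin d) → ℝ} (hu : Measurable u)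
    (S : Set (EuclideanSpace ℝ (Fin d))) :
    ∫⁻ z in S, ‖u z‖ₑ ^ p ≤ (∫⁻ z, ‖u z‖ₑ ^ P) ^ t * volume S ^ (1 - t) := by
  have h := ENNReal.lintegral_mul_norm_pow_le (μ := volume.restrict S) (f := fun z => ‖u z‖ₑ ^ P)
    (g := fun _ => 1) (by fun_prop) (by fun_prop) ht0 (sub_nonneg.2 ht1) (by ring)
  simp only [← ENNReal.rpow_mul, hP, ENNReal.one_rpow, mul_one, lintegral_const,
    Measure.restrict_apply_univ, one_mul] at h
  refine h.trans ?_
  gcongr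
  exact Measure.restrict_le_self

/-- If `r ≤ ‖x‖ / 2`, average over the ball of radius `r` about `x`, where the weights are
comparable, and apply Hölder to the mean of `|u|^p`. If `r > ‖x‖ / 2`, the Hardy term alone
suffices, since `‖x‖ ^ b ≤ (2r) ^ b`. -/
theorem exists_pointwise_scale {d : ℕ} (hd : d ≠ 0) {p P e a₁ a₂ b : ℝ} (hp : 1 ≤ p)
    (he : 0 ≤ e) (ha : 0 ≤ a₁ + a₂) (hb : b = e - d - (a₁ + a₂)) (hb0 : 0 < b) (hbd : b < d)
    (hP : P * (1 - b / d) = p) :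
    ∃ C : ℝ≥0∞, C ≠ 0 ∧ C ≠ ∞ ∧ ∀ u : EuclideanSpace ℝ (Fin d) → ℝ, Measurable u →
      ∀ x ≠ 0, ∀ r : ℝ, 0 < r →
      ‖u x‖ₑ ^ p ≤ C * ENNReal.ofReal (r ^ b) *
        ((∫⁻ z, gagliardoKernel p e a₁ a₂ u z x) + ENNReal.ofReal (‖x‖ ^ (-b)) * ‖u x‖ₑ ^ p
          + ENNReal.ofReal (r ^ (-(d : ℝ))) * (∫⁻ z, ‖u z‖ₑ ^ P) ^ (1 - b / d)) := by
  have hd0 : (0 : ℝ) < d := by exact_mod_cast Nat.pos_of_ne_zero hd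
  set v := volume (Metric.ball (0 : EuclideanSpace ℝ (Fin d)) 1) with hv
  have hv0 : v ≠ 0 := (Metric.measure_ball_pos volume _ one_pos).ne'
  have hvt : v ≠ ∞ := measure_ball_lt_top.ne
  have h2t : (2 : ℝ≥0∞) ^ (p - 1) ≠ ∞ := ENNReal.rpow_ne_top_of_nonneg (by linarith) (by simp)
  have hbd1 : b / d ≤ 1 := by
    rw [div_le_one hd0]
    exact hbd.le
  have hbd0 : 0 ≤ b / d := by positivity
  set A := ENNReal.ofReal (2 ^ |a₁|) with hA
  set B := v ^ (b / d) with hB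
  have hBt : B ≠ ∞ := ENNReal.rpow_ne_top_of_nonneg hbd0 hvt
  set C₁ := v⁻¹ * (2 ^ (p - 1) * (A + B)) with hC₁
  refine ⟨C₁ + ENNReal.ofReal (2 ^ b), ?_, ?_, fun u hu x hx r hr => ?_⟩
  · refine (lt_of_lt_of_le ?_ le_add_self).ne'
    rw [ENNReal.ofReal_pos]
    positivity
  · refine ENNReal.add_ne_top.2 ⟨ENNReal.mul_ne_top (ENNReal.inv_ne_top.2 hv0)
      (ENNReal.mul_ne_top h2t (ENNReal.add_ne_top.2 ⟨ENNReal.ofReal_ne_top, hBt⟩)),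
      ENNReal.ofReal_ne_top⟩
  have hx0 : 0 < ‖x‖ := norm_pos_iff.2 hx
  set F := ∫⁻ z, gagliardoKernel p e a₁ a₂ u z x with hF
  set Q := (∫⁻ z, ‖u z‖ₑ ^ P) ^ (1 - b / d) with hQ
  rcases le_or_gt r (‖x‖ / 2) with hrx | hrx
  · have hball : volume (Metric.ball x r) = ENNReal.ofReal (r ^ d) * v := by
      rw [Measure.addHaar_ball_of_pos volume x hr, finrank_euclideanSpace_fin]
    have h1 := volume_mul_enorm_rpow_le (a₁ := a₁) (a₂ := a₂) (l := 2) (ρ := r)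
      hp he (by norm_num) hx hu (S := Metric.ball x r) measurableSet_ball
      (fun z hz => by
        rw [mem_ball_iff_norm] at hz
        have := norm_sub_norm_le x z
        rw [norm_sub_rev] at this
        linarith)
      (fun z hz => by
        rw [mem_ball_iff_norm] at hz
        have := norm_sub_norm_le z x
        linarith)
      (fun z hz => (mem_ball_iff_norm.1 hz).le)
    have h2 := setLIntegral_enorm_rpow_le (sub_nonneg.2 hbd1) (by linarith) hP hu (Metric.ball x r)
    rw [sub_sub_cancel, hball, ENNReal.mul_rpow_of_nonneg _ _ hbd0,
      ENNReal.ofReal_rpow_of_pos (by positivity), ← Real.rpow_natCast, ← Real.rpow_mul hr.le,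
      mul_div_cancel₀ _ hd0.ne'] at h2
    rw [hball] at h1
    -- As `a₁ + a₂ ≥ 0` and `r ≤ ‖x‖`, the weight `‖x‖ ^ (-(a₁ + a₂))` is at most `r ^ (-(a₁ +
    -- a₂))`.
    have h3 : (2 : ℝ) ^ |a₁| * r ^ e * ‖x‖ ^ (-(a₁ + a₂)) ≤ 2 ^ |a₁| * r ^ (d + b) := by
      rw [show (d : ℝ) + b = e + -(a₁ + a₂) by rw [hb]; ring, Real.rpow_add hr, mul_assoc]
      gcongr 2 ^ |a₁| * (r ^ e * ?_)
      exact Real.rpow_le_rpow_of_nonpos hr (by linarith) (by linarith)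
    have h4 : v * (ENNReal.ofReal (r ^ d) * ‖u x‖ₑ ^ p) ≤ 2 ^ (p - 1) * (A + B) *
        (ENNReal.ofReal (r ^ b) * (ENNReal.ofReal (r ^ d) * F + Q)) := by
      calc v * (ENNReal.ofReal (r ^ d) * ‖u x‖ₑ ^ p)
          = ENNReal.ofReal (r ^ d) * v * ‖u x‖ₑ ^ p := by ring
        _ ≤ _ := h1
        _ ≤ 2 ^ (p - 1) * (ENNReal.ofReal (2 ^ |a₁| * r ^ (d + b)) * F
              + Q * (ENNReal.ofReal (r ^ b) * B)) := by
            gcongr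
        _ = 2 ^ (p - 1) * (A * (ENNReal.ofReal (r ^ b) * (ENNReal.ofReal (r ^ d) * F))
              + B * (ENNReal.ofReal (r ^ b) * Q)) := by
            rw [ENNReal.ofReal_mul (by positivity), Real.rpow_add hr, Real.rpow_natCast,
              ENNReal.ofReal_mul (by positivity)]
            ring
        _ ≤ 2 ^ (p - 1) * ((A + B) * (ENNReal.ofReal (r ^ b) * (ENNReal.ofReal (r ^ d) * F))
              + (A + B) * (ENNReal.ofReal (r ^ b) * Q)) := by
            gcongr
            · exact le_self_add
            · exact le_add_self
        _ = _ := by ring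
    have hrd : ENNReal.ofReal (r ^ d) ≠ 0 := by
      rw [ENNReal.ofReal_ne_zero_iff]
      positivity
    have h5 : ENNReal.ofReal (r ^ (-(d : ℝ))) = (ENNReal.ofReal (r ^ d))⁻¹ := by
      rw [Real.rpow_neg hr.le, Real.rpow_natCast, ENNReal.ofReal_inv_of_pos (by positivity)]
    have h6 : ∀ a c : ℝ≥0∞, a ≠ 0 → a ≠ ∞ → a⁻¹ * (a * c) = c := fun a c h0 ht => by
      rw [← mul_assoc, ENNReal.inv_mul_cancel h0 ht, one_mul]
    calc ‖u x‖ₑ ^ p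
        = (ENNReal.ofReal (r ^ d))⁻¹ * (v⁻¹ * (v * (ENNReal.ofReal (r ^ d) * ‖u x‖ₑ ^ p))) := by
          rw [h6 v _ hv0 hvt, h6 _ _ hrd ENNReal.ofReal_ne_top]
      _ ≤ (ENNReal.ofReal (r ^ d))⁻¹ * (v⁻¹ * (2 ^ (p - 1) * (A + B) *
            (ENNReal.ofReal (r ^ b) * (ENNReal.ofReal (r ^ d) * F + Q)))) := by gcongr
      _ = C₁ * ENNReal.ofReal (r ^ b) * ((ENNReal.ofReal (r ^ d))⁻¹ * (ENNReal.ofReal (r ^ d) * F)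
            + (ENNReal.ofReal (r ^ d))⁻¹ * Q) := by rw [hC₁]; ring
      _ = C₁ * ENNReal.ofReal (r ^ b) * (F + ENNReal.ofReal (r ^ (-(d : ℝ))) * Q) := by
          rw [h6 _ _ hrd ENNReal.ofReal_ne_top, h5]
      _ ≤ _ := by
          gcongr
          · exact le_self_add
          · exact le_self_add
  · calc ‖u x‖ₑ ^ p = ENNReal.ofReal (‖x‖ ^ b) * (ENNReal.ofReal (‖x‖ ^ (-b)) * ‖u x‖ₑ ^ p) := by
          rw [← mul_assoc, ← ENNReal.ofReal_mul (by positivity), ← Real.rpow_add hx0]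
          simp
      _ ≤ ENNReal.ofReal ((2 * r) ^ b) * (ENNReal.ofReal (‖x‖ ^ (-b)) * ‖u x‖ₑ ^ p) := by
          gcongr
          linarith
      _ = ENNReal.ofReal (2 ^ b) * ENNReal.ofReal (r ^ b)
            * (ENNReal.ofReal (‖x‖ ^ (-b)) * ‖u x‖ₑ ^ p) := by
          rw [Real.mul_rpow (by norm_num) hr.le, ENNReal.ofReal_mul (by positivity)]
      _ ≤ _ := by
          gcongr
          · exact le_add_self
          · exact le_add_self.trans le_self_add

/-! ### The weighted Sobolev inequality -/

theorem exists_sobolev_of_lintegral_ne_top {d : ℕ} (hd : d ≠ 0) {p P e a₁ a₂ b : ℝ} (hp : 1 ≤ p)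
    (he : 0 ≤ e) (ha : 0 ≤ a₁ + a₂) (hb : b = e - d - (a₁ + a₂)) (hb0 : 0 < b) (hbd : b < d)
    (hP : P * (1 - b / d) = p) :
    ∃ C : ℝ≥0∞, C ≠ ∞ ∧ ∀ u : EuclideanSpace ℝ (Fin d) → ℝ, Measurable u →
      ∫⁻ x, ‖u x‖ₑ ^ p ≠ ∞ → ∫⁻ x, ‖u x‖ₑ ^ P ≠ ∞ →
      (∫⁻ x, ‖u x‖ₑ ^ P) ^ (1 - b / d) ≤ C * gagliardoEnergy p e a₁ a₂ u := by
  have hd0 : (0 : ℝ) < d := by exact_mod_cast Nat.pos_of_ne_zero hd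
  obtain ⟨H, hHt, hH⟩ := exists_hardy hd hp he hb hb0 hbd
  obtain ⟨c, hc0, hct, hc⟩ := exists_pointwise_scale hd hp he ha hb hb0 hbd hP
  set t := 1 - b / d with ht
  have ht0 : 0 < t := by
    rw [ht, sub_pos, div_lt_one hd0]
    exact hbd
  have hbt : b / d = 1 - t := by rw [ht]; ring
  have hPt : P = p * (1 / t) := by
    rw [← hP]
    field_simp
  have hKt : (2 * c) ^ (1 / t) ≠ ∞ :=
    ENNReal.rpow_ne_top_of_nonneg (by positivity) (ENNReal.mul_ne_top (by simp) hct)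
  refine ⟨(2 * c) ^ (1 / t) * (1 + H), ENNReal.mul_ne_top hKt (by simp [hHt]),
    fun u hu hup huP => ?_⟩
  set Q := ∫⁻ x, ‖u x‖ₑ ^ P with hQ
  rcases eq_or_ne Q 0 with hQ0 | hQ0
  · rw [hQ0, ENNReal.zero_rpow_of_pos ht0]
    exact zero_le
  have hpt : ∀ᵐ x : EuclideanSpace ℝ (Fin d), ‖u x‖ₑ ^ P ≤ (2 * c) ^ (1 / t) * Q ^ (1 - t) *
      ((∫⁻ z, gagliardoKernel p e a₁ a₂ u z x) + ENNReal.ofReal (‖x‖ ^ (-b)) * ‖u x‖ₑ ^ p) := by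
    filter_upwards [ae_ne_zero_euclideanSpace hd] with x hx
    have hx0 : 0 < ‖x‖ := norm_pos_iff.2 hx
    have h := ENNReal.le_of_forall_scale (Q := Q ^ t) hd0 hbd hc0
      (ENNReal.rpow_pos (pos_iff_ne_zero.2 hQ0) huP).ne' (ENNReal.rpow_ne_top_of_nonneg ht0.le huP)
      -- The Hardy term vanishes at `x ≠ 0` only if `u x = 0`.
      (fun h0 => by
        have h1 := (add_eq_zero.1 h0).2
        refine (mul_eq_zero.1 h1).resolve_left ?_
        rw [ENNReal.ofReal_eq_zero, not_le]
        positivity) (hc u hu x hx)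
    rw [← ht, hbt] at h
    -- The power `1 / t` makes the bound linear in the densities, hence integrable term by term.
    have h' := ENNReal.rpow_le_rpow h (by positivity : 0 ≤ 1 / t)
    rw [← ENNReal.rpow_mul, ← hPt, ENNReal.mul_rpow_of_nonneg (2 * c) _ (by positivity),
      ENNReal.mul_rpow_of_nonneg ((Q ^ t) ^ (1 - t)) _ (by positivity), ← ENNReal.rpow_mul,
      ← ENNReal.rpow_mul, ← ENNReal.rpow_mul, mul_one_div_cancel ht0.ne', ENNReal.rpow_one, ← mul_assoc,
      show t * ((1 - t) * (1 / t)) = 1 - t by field_simp] at h'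
    exact h'
  have hQ1 : Q ^ (1 - t) ≠ 0 := (ENNReal.rpow_pos (pos_iff_ne_zero.2 hQ0) huP).ne'
  have hQ1t : Q ^ (1 - t) ≠ ∞ := by
    refine ENNReal.rpow_ne_top_of_nonneg ?_ huP
    rw [← hbt]
    positivity
  have hint : Q ≤ Q ^ (1 - t) *
      ((2 * c) ^ (1 / t) * (1 + H) * gagliardoEnergy p e a₁ a₂ u) := by
    calc Q ≤ ∫⁻ x, (2 * c) ^ (1 / t) * Q ^ (1 - t) *
          ((∫⁻ z, gagliardoKernel p e a₁ a₂ u z x)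
            + ENNReal.ofReal (‖x‖ ^ (-b)) * ‖u x‖ₑ ^ p) := lintegral_mono_ae hpt
      _ = (2 * c) ^ (1 / t) * Q ^ (1 - t) * (gagliardoEnergy p e a₁ a₂ u
            + ∫⁻ x, ENNReal.ofReal (‖x‖ ^ (-b)) * ‖u x‖ₑ ^ p) := by
          rw [lintegral_const_mul' _ _ (ENNReal.mul_ne_top hKt hQ1t),
            lintegral_add_right _ (by fun_prop)]
          rfl
      _ ≤ (2 * c) ^ (1 / t) * Q ^ (1 - t) * (gagliardoEnergy p e a₁ a₂ u
            + H * gagliardoEnergy p e a₁ a₂ u) := by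
          gcongr
          exact hH u hu hup
      _ = _ := by ring
  have hsplit : Q = Q ^ (1 - t) * Q ^ t := by
    rw [← ENNReal.rpow_add _ _ hQ0 huP, sub_add_cancel, ENNReal.rpow_one]
  exact (ENNReal.mul_le_mul_iff_right hQ1 hQ1t).1 (hsplit.symm.le.trans hint)

theorem gagliardoEnergy_congr_ae {d : ℕ} {p e a₁ a₂ : ℝ} {u w : EuclideanSpace ℝ (Fin d) → ℝ}
    (h : u =ᵐ[volume] w) : gagliardoEnergy p e a₁ a₂ u = gagliardoEnergy p e a₁ a₂ w := by
  refine lintegral_congr_ae ?_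
  filter_upwards [h] with x hx
  refine lintegral_congr_ae ?_
  filter_upwards [h] with z hz
  simp only [gagliardoKernel, hx, hz]

/-- Applied to truncations, which are 1-Lipschitz functions of `u`. -/
theorem gagliardoEnergy_mono {d : ℕ} {p e a₁ a₂ : ℝ} {u w : EuclideanSpace ℝ (Fin d) → ℝ}
    (hp : 0 ≤ p) (h : ∀ z x, |w z - w x| ≤ |u z - u x|) :
    gagliardoEnergy p e a₁ a₂ w ≤ gagliardoEnergy p e a₁ a₂ u := by
  refine lintegral_mono fun x => lintegral_mono fun z => ENNReal.ofReal_le_ofReal ?_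
  have := h z x
  gcongr

theorem abs_max_min_sub_max_min_le (T a c : ℝ) :
    |max (-T) (min a T) - max (-T) (min c T)| ≤ |a - c| := by
  refine (abs_max_sub_max_le_max _ _ _ _).trans ?_
  rw [sub_self, abs_zero, max_eq_right (abs_nonneg _)]
  refine (abs_min_sub_min_le_max _ _ _ _).trans ?_
  rw [sub_self, abs_zero, max_eq_left (abs_nonneg _)]

/-- The weighted fractional Sobolev inequality, for every function in `L^p`. -/
theorem exists_sobolev {d : ℕ} (hd : d ≠ 0) {p P e a₁ a₂ b : ℝ} (hp : 1 ≤ p)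
    (he : 0 ≤ e) (ha : 0 ≤ a₁ + a₂) (hb : b = e - d - (a₁ + a₂)) (hb0 : 0 < b) (hbd : b < d)
    (hP : P * (1 - b / d) = p) :
    ∃ C : ℝ≥0∞, C ≠ ∞ ∧ ∀ u : EuclideanSpace ℝ (Fin d) → ℝ, AEMeasurable u →
      ∫⁻ x, ‖u x‖ₑ ^ p ≠ ∞ →
      ∫⁻ x, ‖u x‖ₑ ^ P ≤ (C * gagliardoEnergy p e a₁ a₂ u) ^ (1 / (1 - b / d)) := by
  have hd0 : (0 : ℝ) < d := by exact_mod_cast Nat.pos_of_ne_zero hd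
  obtain ⟨C, hCt, hC⟩ := exists_sobolev_of_lintegral_ne_top hd hp he ha hb hb0 hbd hP
  have ht0 : 0 < 1 - b / d := by
    rw [sub_pos, div_lt_one hd0]
    exact hbd
  have hpP : p ≤ P := by
    have : 0 < b / d := by positivity
    have : 0 < P := pos_of_mul_pos_left (by linarith : 0 < P * (1 - b / d)) ht0.le
    nlinarith
  refine ⟨C, hCt, fun u₀ hu₀ hu₀p => ?_⟩
  obtain ⟨u, hu, hae⟩ := hu₀
  have hpow : ∀ k : ℝ, ∫⁻ x, ‖u₀ x‖ₑ ^ k = ∫⁻ x, ‖u x‖ₑ ^ k := fun k => by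
    refine lintegral_congr_ae ?_
    filter_upwards [hae] with x hx
    rw [hx]
  rw [hpow] at hu₀p
  rw [hpow, gagliardoEnergy_congr_ae hae]
  -- Truncation at height `n` gives `|w n|^P ≤ n^(P - p) |w n|^p`, hence the finite `L^P` norm
  -- required above, without raising the energy.
  set w : ℕ → EuclideanSpace ℝ (Fin d) → ℝ := fun n x => max (-(n : ℝ)) (min (u x) n) with hw
  have hwm : ∀ n, Measurable (w n) := fun n => by fun_prop
  have hwu : ∀ n x, ‖w n x‖ₑ ≤ ‖u x‖ₑ := fun n x => by
    rw [enorm_le_iff_norm_le, Real.norm_eq_abs, Real.norm_eq_abs]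
    have := abs_max_min_sub_max_min_le n (u x) 0
    simpa using this
  have hwn : ∀ (n : ℕ) x, ‖w n x‖ₑ ≤ (n : ℝ≥0∞) := fun n x => by
    rw [Real.enorm_eq_ofReal_abs, ← ENNReal.ofReal_natCast]
    refine ENNReal.ofReal_le_ofReal (abs_le.2 ⟨le_max_left _ _, max_le ?_ (min_le_right _ _)⟩)
    linarith [Nat.cast_nonneg (α := ℝ) n]
  have hwp : ∀ n, ∫⁻ x, ‖w n x‖ₑ ^ p ≠ ∞ := fun n => by
    refine ne_top_of_le_ne_top hu₀p (lintegral_mono fun x => ?_)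
    gcongr
    exact hwu n x
  have hwP : ∀ n, ∫⁻ x, ‖w n x‖ₑ ^ P ≠ ∞ := fun n => by
    have hnt : (n : ℝ≥0∞) ^ (P - p) ≠ ∞ :=
      ENNReal.rpow_ne_top_of_nonneg (by linarith) (ENNReal.natCast_ne_top n)
    refine ne_top_of_le_ne_top (ENNReal.mul_ne_top hnt (hwp n)) ?_
    rw [← lintegral_const_mul' _ _ hnt]
    refine lintegral_mono fun x => ?_
    calc ‖w n x‖ₑ ^ P = ‖w n x‖ₑ ^ (P - p) * ‖w n x‖ₑ ^ p := by
          rw [← ENNReal.rpow_add_of_nonneg _ _ (by linarith) (by linarith), sub_add_cancel]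
      _ ≤ _ := by
          gcongr
          exact hwn n x
  have hbound : ∀ n, ∫⁻ x, ‖w n x‖ₑ ^ P
      ≤ (C * gagliardoEnergy p e a₁ a₂ u) ^ (1 / (1 - b / d)) := fun n => by
    rw [one_div, ENNReal.le_rpow_inv_iff ht0]
    refine (hC (w n) (hwm n) (hwp n) (hwP n)).trans ?_
    gcongr
    exact gagliardoEnergy_mono (by linarith) fun z x => abs_max_min_sub_max_min_le _ _ _
  have hlim : ∀ x, liminf (fun n => ‖w n x‖ₑ ^ P) atTop = ‖u x‖ₑ ^ P := fun x => by
    refine Tendsto.liminf_eq (tendsto_const_nhds.congr' ?_)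
    obtain ⟨N, hN⟩ := exists_nat_ge |u x|
    filter_upwards [eventually_ge_atTop N] with n hn
    have hn' : |u x| ≤ n := hN.trans (by exact_mod_cast hn)
    rw [hw]
    simp only
    rw [min_eq_left (abs_le.1 hn').2, max_eq_right (abs_le.1 hn').1]
  calc ∫⁻ x, ‖u x‖ₑ ^ P = ∫⁻ x, liminf (fun n => ‖w n x‖ₑ ^ P) atTop := by simp_rw [hlim]
    _ ≤ liminf (fun n => ∫⁻ x, ‖w n x‖ₑ ^ P) atTop := lintegral_liminf_le fun n => by fun_prop
    _ ≤ _ := liminf_le_of_frequently_le' (Frequently.of_forall hbound)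

/-! ### Interpolation and the main theorem -/

theorem eLpNorm_ofReal_eq {X : Type*} [MeasurableSpace X] {μ : Measure X} {q : ℝ} (hq : 0 < q)
    (u : X → ℝ) : eLpNorm u (ENNReal.ofReal q) μ = (∫⁻ x, ‖u x‖ₑ ^ q ∂μ) ^ (1 / q) := by
  rw [eLpNorm_eq_lintegral_rpow_enorm_toReal (by simpa using hq) ENNReal.ofReal_ne_top,
    ENNReal.toReal_ofReal hq.le]

/-- Interpolation of `L^r` between `L^P` and `L^q`. -/
theorem eLpNorm_le_eLpNorm_rpow_mul_eLpNorm_rpow {X : Type*} [MeasurableSpace X] {μ : Measure X}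
    {P q r a : ℝ} (hP : 0 < P) (hq : 0 < q) (hr : 0 < r) (ha0 : 0 ≤ a) (ha1 : a ≤ 1)
    (h : 1 / r = a / P + (1 - a) / q) {u : X → ℝ} (hu : AEMeasurable u μ) :
    eLpNorm u (ENNReal.ofReal r) μ
      ≤ eLpNorm u (ENNReal.ofReal P) μ ^ a * eLpNorm u (ENNReal.ofReal q) μ ^ (1 - a) := by
  have h1a : 0 ≤ 1 - a := by linarith
  have hH := ENNReal.lintegral_mul_norm_pow_le (μ := μ) (f := fun x => ‖u x‖ₑ ^ P)
    (g := fun x => ‖u x‖ₑ ^ q) (by fun_prop) (by fun_prop) (p := r * a / P)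
    (q := r * (1 - a) / q) (by positivity) (by positivity)
    (by
      have : r * (1 / r) = 1 := by field_simp
      rw [h] at this
      linear_combination this)
  have hpt : ∀ x, (‖u x‖ₑ ^ P) ^ (r * a / P) * (‖u x‖ₑ ^ q) ^ (r * (1 - a) / q) = ‖u x‖ₑ ^ r := by
    intro x
    rw [← ENNReal.rpow_mul, ← ENNReal.rpow_mul,
      ← ENNReal.rpow_add_of_nonneg _ _ (by positivity) (by positivity)]
    congr 1
    field_simp
    ring
  simp_rw [hpt] at hH
  rw [eLpNorm_ofReal_eq hr, eLpNorm_ofReal_eq hP, eLpNorm_ofReal_eq hq, ← ENNReal.rpow_mul,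
    ← ENNReal.rpow_mul]
  refine (ENNReal.rpow_le_rpow hH (by positivity : 0 ≤ 1 / r)).trans (le_of_eq ?_)
  rw [ENNReal.mul_rpow_of_nonneg _ _ (by positivity), ← ENNReal.rpow_mul, ← ENNReal.rpow_mul]
  congr 2 <;> field_simp

theorem theorem3p2 (d : ℕ) (p s α₁ α₂ α : ℝ) (hp : 1 < p) (hs0 : 0 < s) (hs1 : s < 1)
    (hα : α = α₁ + α₂)
    (hα₁ : α₁ * p ∈ Set.Ioo (-(d : ℝ)) (s * p))
    (hα₂ : α₂ * p ∈ Set.Ioo (-(d : ℝ)) (s * p))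
    (hα0 : 0 ≤ α * p) (hαs : α * p < s * p) (hd : s * p - α * p < d) :
    ∃ C : ℝ, 0 < C ∧
      (∀ u ∈ WeightedSobolev d s p α₁ α₂,
        eLpNorm u (ENNReal.ofReal (d * p / (d - s * p + α * p))) volume
          ≤ ENNReal.ofReal (C ^ (1 / p)) * weightedGagliardo d s p α₁ α₂ u) ∧
      ∀ q r a : ℝ, p < q → q < p * (d - s + α) / (d - s * p + α * p) →
        r = p * ((q - 1) / (p - 1)) →
        a = d * (q - p) / ((q - 1) * (d * p - (d - s * p + α * p) * q)) →
        0 < d * p - (d - s * p + α * p) * q ∧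
        ∀ u ∈ WeightedD d s p q α₁ α₂,
          eLpNorm u (ENNReal.ofReal r) volume
            ≤ ENNReal.ofReal (C ^ (a / p)) * weightedGagliardo d s p α₁ α₂ u ^ a
              * eLpNorm u (ENNReal.ofReal q) volume ^ (1 - a) := by
  have hp0 : 0 < p := by linarith
  have hd0 : (0 : ℝ) < d := by linarith
  have hdn : d ≠ 0 := by
    rintro rfl
    simp at hd0
  have hD : 0 < d - s * p + α * p := by linarith
  have hαs' : α < s := lt_of_mul_lt_mul_right hαs hp0.le
  set P := d * p / (d - s * p + α * p) with hPdef
  have hP0 : 0 < P := by positivity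
  have ht : 1 - (s * p - α * p) / d = (d - s * p + α * p) / d := by
    field_simp
    ring
  have hPt : P * (1 - (s * p - α * p) / d) = p := by
    rw [ht, hPdef, div_mul_div_cancel₀ hD.ne', mul_div_cancel_left₀ _ hd0.ne']
  obtain ⟨C₀, hC₀t, hC₀⟩ := exists_sobolev hdn (p := p) (P := P) (e := d + s * p) (a₁ := α₁ * p)
    (a₂ := α₂ * p) (b := s * p - α * p) hp.le (by positivity) (by rw [← add_mul, ← hα]; exact hα0)
    (by rw [hα]; ring) (by linarith) hd hPt
  have hsob : ∀ u ∈ WeightedSobolev d s p α₁ α₂, eLpNorm u (ENNReal.ofReal P) volume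
      ≤ ENNReal.ofReal ((C₀.toReal + 1) ^ (1 / p)) * weightedGagliardo d s p α₁ α₂ u := by
    rintro u ⟨hu, -⟩
    have hup : ∫⁻ x, ‖u x‖ₑ ^ p ≠ ∞ := by
      have h := hu.2
      rw [eLpNorm_ofReal_eq hp0, ENNReal.rpow_lt_top_iff_of_pos (by positivity)] at h
      exact h.ne
    have h := hC₀ u hu.1.aemeasurable hup
    rw [eLpNorm_ofReal_eq hP0, weightedGagliardo_eq, ← ENNReal.ofReal_rpow_of_pos (by positivity),
      ← ENNReal.mul_rpow_of_nonneg _ _ (by positivity)]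
    calc (∫⁻ x, ‖u x‖ₑ ^ P) ^ (1 / P) ≤ _ := ENNReal.rpow_le_rpow h (by positivity)
      _ = (C₀ * gagliardoEnergy p (d + s * p) (α₁ * p) (α₂ * p) u) ^ (1 / p) := by
          rw [← ENNReal.rpow_mul, one_div_mul_one_div, mul_comm _ P, hPt]
      _ ≤ _ := by
          gcongr
          rw [ENNReal.ofReal_add ENNReal.toReal_nonneg zero_le_one, ENNReal.ofReal_toReal hC₀t]
          exact le_self_add
  have hC0 : 0 < C₀.toReal + 1 := by positivity
  -- Adding 1 makes the constant positive even if `C₀ = 0`.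
  refine ⟨C₀.toReal + 1, hC0, hsob, fun q r a hpq hq hr ha => ?_⟩
  rw [lt_div_iff₀ hD] at hq
  -- The bound on `q` leaves at least `dp - p(d - s + α) = p(s - α) > 0`.
  have hpos : 0 < d * p - (d - s * p + α * p) * q := by nlinarith
  refine ⟨hpos, fun u hu => ?_⟩
  have hq1 : 0 < q - 1 := by linarith
  have hp1 : 0 < p - 1 := by linarith
  have hqp : 0 < q - p := by linarith
  have ha0 : 0 ≤ a := by
    rw [ha]
    positivity
  have ha1 : a ≤ 1 := by
    rw [ha, div_le_one (by positivity)]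
    -- With `D = d - sp + αp`, this product equals `(q - 1)(dp - Dq) - d(q - p)`. Its second factor
    -- is nonnegative by the bound on `q`, since `p(d - s + α) = D + d(p - 1)`.
    have h1 : 0 ≤ q * (d * (p - 1) - (d - s * p + α * p) * (q - 1)) :=
      mul_nonneg (by linarith) (by linarith)
    linarith
  have hr0 : 0 < r := by
    rw [hr]
    positivity
  have hrel : 1 / r = a / P + (1 - a) / q := by
    rw [hr, ha, hPdef]
    have : 0 < q := by linarith
    generalize d - s * p + α * p = D at *
    generalize hm : d * p - D * q = m at *
    field_simp
    rw [← hm]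
    ring
  have hint := eLpNorm_le_eLpNorm_rpow_mul_eLpNorm_rpow (μ := volume) hP0 (by linarith : 0 < q)
    hr0 ha0 ha1 hrel hu.2.1.1.aemeasurable
  refine hint.trans ?_
  gcongr
  refine (ENNReal.rpow_le_rpow (hsob u hu.1) ha0).trans (le_of_eq ?_)
  rw [ENNReal.mul_rpow_of_nonneg _ _ ha0, ENNReal.ofReal_rpow_of_pos (by positivity),
    ← Real.rpow_mul hC0.le, one_div_mul_eq_div]
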